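/- All matrices are complex, $\|X\|_1=\operatorname{tr}\sqrt{X^*X}$ is the trace norm, $X\ge 0$ means that $X$ is positive semidefinite, $\sqrt X$ is the positive semidefinite square root of $X\geq 0$, and $\sigma(X)$ is the spectrum of $X$. A linear map $T:\mathbb C^{n\times n}\to\mathbb C^{n\times n}$ is positive if $X\ge 0$ implies $T(X)\ge 0$, completely positive if $T\otimes\mathrm{id}_m$ is positive for all $m\in\mathbb N$, and trace-preserving if $\operatorname{tr}T(X)=\operatorname{tr}X$ for all $X$. Let $d=(d_1,d_2)$ with $d_1,d_2>0$, let $D=\operatorname{diag}(d_1,d_2)$, and let $A,B\in\mathbb C^{2\times2}$ be Hermitian. Write $\sigma(D^{-1/2}BD^{-1/2})=\{b_1,b_2\}$ with $b_1\le b_2$. Then the following are equivalent: (i) $A\prec_D B$, that is, there is a completely positive, trace-preserving linear map $T:\mathbb C^{2\times2}\to\mathbb C^{2\times2}$ with $T(B)=A$ and $T(D)=D$. (ii) There is a positive, trace-preserving linear map $T:\mathbb C^{2\times2}\to\mathbb C^{2\times2}$ with $T(B)=A$ and $T(D)=D$. (iii) $\|A-tD\|_1\le\|B-tD\|_1$ for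 all $t\in\mathbb R$. (iv) $\operatorname{tr}(A)=\operatorname{tr}(B)$, $\|A-b_iD\|_1\le\|B-b_iD\|_1$ for $i=1,2$, and $$\big\|\sqrt{A-b_1D}\,\sqrt{b_2D-A}\big\|_1\ \ge\ \big\|\sqrt{B-b_1D}\,\sqrt{b_2D-B}\big\|_1 .$$ (The trace equality and the two norm inequalities in (iv) imply $A-b_1D\ge0$ and $b_2D-A\ge0$, so these square roots are defined whenever the last inequality is required.) -/

import Mathlib

open Matrix
open scoped ComplexOrder MatrixOrder Kronecker

noncomputable section

/-- The trace norm of a complex square matrix, the trace of the square root of `Aᴴ * A`.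
That square root is positive semidefinite, so its trace is a nonnegative real number. -/
def traceNorm {n : ℕ} (A : Matrix (Fin n) (Fin n) ℂ) : ℝ :=
  (CFC.sqrt (Aᴴ * A)).trace.re

/-- The ampliation `T ⊗ id_m`, acting on square matrices indexed by `Fin n × Fin m`:
`T` is applied to each of the `m * m` blocks of size `n × n`. -/
def ampliation {n k : ℕ} (T : Matrix (Fin n) (Fin n) ℂ →ₗ[ℂ] Matrix (Fin k) (Fin k) ℂ) (m : ℕ) :
    Matrix (Fin n × Fin m) (Fin n × Fin m) ℂ →ₗ[ℂ]
      Matrix (Fin k × Fin m) (Fin k × Fin m) ℂ where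
  toFun X := Matrix.of fun p q =>
    T (Matrix.of fun i j => X (i, p.2) (j, q.2)) p.1 q.1
  map_add' X Y := by
    ext p q
    have h : (Matrix.of fun i j => (X + Y) (i, p.2) (j, q.2)) =
        (Matrix.of fun i j => X (i, p.2) (j, q.2)) +
          (Matrix.of fun i j => Y (i, p.2) (j, q.2)) := rfl
    simp only [Matrix.of_apply, Matrix.add_apply] at *
    rw [h, map_add, Matrix.add_apply]
  map_smul' c X := by
    ext p q
    have h : (Matrix.of fun i j => (c • X) (i, p.2) (j, q.2)) =
        c • (Matrix.of fun i j => X (i, p.2) (j, q.2)) := rfl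
    simp only [Matrix.of_apply, Matrix.smul_apply, RingHom.id_apply] at *
    rw [h, map_smul, Matrix.smul_apply]

/-- `T ⊗ id_m` is determined by its value on Kronecker products. -/
theorem ampliation_kronecker {n k : ℕ}
    (T : Matrix (Fin n) (Fin n) ℂ →ₗ[ℂ] Matrix (Fin k) (Fin k) ℂ) (m : ℕ)
    (X : Matrix (Fin n) (Fin n) ℂ) (Y : Matrix (Fin m) (Fin m) ℂ) :
    ampliation T m (X ⊗ₖ Y) = T X ⊗ₖ Y := by
  ext p q
  have h : (Matrix.of fun i j => (X ⊗ₖ Y) (i, p.2) (j, q.2)) = Y p.2 q.2 • X := by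
    ext i j
    simp [mul_comm]
  change T (Matrix.of fun i j => (X ⊗ₖ Y) (i, p.2) (j, q.2)) p.1 q.1 = _
  rw [h, map_smul]
  simp [mul_comm]

/-- A linear map between matrix spaces (with arbitrary index types) is positive if it maps
positive semidefinite matrices to positive semidefinite matrices. -/
def IsPositiveMap {ι κ : Type} [Fintype ι] [Fintype κ]
    (T : Matrix ι ι ℂ →ₗ[ℂ] Matrix κ κ ℂ) : Prop :=
  ∀ X : Matrix ι ι ℂ, X.PosSemidef → (T X).PosSemidef

/-- `T` is completely positive if `T ⊗ id_m` is positive for every `m`. -/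
def IsCompletelyPositiveMap {n k : ℕ}
    (T : Matrix (Fin n) (Fin n) ℂ →ₗ[ℂ] Matrix (Fin k) (Fin k) ℂ) : Prop :=
  ∀ m : ℕ, IsPositiveMap (ampliation T m)

/-- `T` preserves the trace. -/
def IsTracePreserving {n k : ℕ}
    (T : Matrix (Fin n) (Fin n) ℂ →ₗ[ℂ] Matrix (Fin k) (Fin k) ℂ) : Prop :=
  ∀ X : Matrix (Fin n) (Fin n) ℂ, (T X).trace = X.trace

/-- Quantum channels on `n × n` matrices: linear, completely positive, trace preserving maps. -/
def IsQuantumChannel {n : ℕ}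
    (T : Matrix (Fin n) (Fin n) ℂ →ₗ[ℂ] Matrix (Fin n) (Fin n) ℂ) : Prop :=
  IsCompletelyPositiveMap T ∧ IsTracePreserving T

/-- `A ≺_D B`: some quantum channel with fixed point `D` maps `B` to `A`. -/
def DMajorizedBy {n : ℕ} (D A B : Matrix (Fin n) (Fin n) ℂ) : Prop :=
  ∃ T : Matrix (Fin n) (Fin n) ℂ →ₗ[ℂ] Matrix (Fin n) (Fin n) ℂ,
    IsQuantumChannel T ∧ T B = A ∧ T D = D

/-- The diagonal matrix with real diagonal `d`, as a complex matrix. -/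
def realDiag {n : ℕ} (d : Fin n → ℝ) : Matrix (Fin n) (Fin n) ℂ :=
  Matrix.diagonal fun i => (d i : ℂ)

/-- The inverse square root `D^{-1/2}` of a positive definite matrix. -/
def invSqrt {n : ℕ} (D : Matrix (Fin n) (Fin n) ℂ) : Matrix (Fin n) (Fin n) ℂ :=
  (CFC.sqrt D)⁻¹

end

/-!
Let `b₁ ≤ b₂` be the eigenvalues of `D^{-1/2} B D^{-1/2}`. The two matrices `B - b₁ D` and
`b₂ D - B` are positive semidefinite and singular, so they have the form `u uᴴ` and `v vᴴ`, and
they add up to `(b₂ - b₁) D` (`exists_vecMulVec_of_spectrum`). If `b₁ < b₂`, a channel that fixes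
`D` and maps `B` to `A` is therefore the same as a channel that maps the pair of pure states `u uᴴ`,
`v vᴴ` to the pair `P = A - b₁ D`, `Q = b₂ D - A`.

Completely positive maps are positive, and positive trace-preserving maps contract the trace norm
on Hermitian matrices (`IsPositiveMap.traceNorm_map_le`). Conversely, the trace norm inequalities
at `t = b₁` and `t = b₂` already contain everything. They give `tr A = tr B`, hence `P ≥ 0` and
`Q ≥ 0` by `posSemidef_of_traceNorm_le`. In dimension two the inequality between the fidelities
is then automatic: the squared fidelity of `P` and `Q` is `(√det P + √det Q)²` plus a quantity
depending only on `P + Q` and the traces, and the determinants vanish for the pair coming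
from `B` (`traceNorm_sqrt_mul_sqrt_le`).

The channel is built from the fidelity inequality `|⟨u, v⟩| ≤ ‖√P √Q‖₁` as in Uhlmann's theorem.
There is a multiple `W` of a unitary matrix, with factor at most one, such that
`tr (√P √Q W) = ⟨u, v⟩` (`exists_trace_mul_eq`). Completing `W` to a coisometry turns `√P` and `√Q`
into purifications of `P` and `Q` with the Gram matrix of `u` and `v`. Since `u` and `v` form a
basis, mapping them to these purifications defines an isometry, and the partial trace over the
purifying space gives a channel (`exists_isQuantumChannel_of_gram`,
`exists_isQuantumChannel_of_fidelity_le`). If `b₁ = b₂`, then `A = B` and the identity does.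
-/

open Matrix
open scoped ComplexOrder MatrixOrder Kronecker

/-! ### The trace norm -/

section TraceNorm

variable {n : ℕ} {P Q H : Matrix (Fin n) (Fin n) ℂ}

theorem posSemidef_sqrt (X : Matrix (Fin n) (Fin n) ℂ) : (CFC.sqrt X).PosSemidef :=
  nonneg_iff_posSemidef.mp (CFC.sqrt_nonneg X)

theorem Matrix.PosSemidef.re_trace_nonneg (hP : P.PosSemidef) : 0 ≤ P.trace.re :=
  (Complex.nonneg_iff.mp hP.trace_nonneg).1

theorem Matrix.PosSemidef.re_det_nonneg (hP : P.PosSemidef) : 0 ≤ P.det.re :=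
  (Complex.nonneg_iff.mp hP.det_nonneg).1

theorem Matrix.PosSemidef.eq_zero_of_re_trace_nonpos (hP : P.PosSemidef)
    (h : P.trace.re ≤ 0) : P = 0 := by
  rw [← hP.trace_eq_zero_iff]
  exact Complex.ext (le_antisymm h hP.re_trace_nonneg)
    (Complex.nonneg_iff.mp hP.trace_nonneg).2.symm

theorem traceNorm_nonneg (X : Matrix (Fin n) (Fin n) ℂ) : 0 ≤ traceNorm X :=
  (posSemidef_sqrt _).re_trace_nonneg

theorem traceNorm_of_posSemidef (hP : P.PosSemidef) : traceNorm P = P.trace.re := by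
  rw [traceNorm, hP.isHermitian.eq, CFC.sqrt_mul_self P hP.nonneg]

/-- The Jordan decomposition of a Hermitian matrix. -/
theorem exists_posSemidef_sub_eq (hH : H.IsHermitian) :
    ∃ P Q : Matrix (Fin n) (Fin n) ℂ, P.PosSemidef ∧ Q.PosSemidef ∧ P - Q = H ∧
      traceNorm H = P.trace.re + Q.trace.re := by
  have hs : IsSelfAdjoint H := hH
  refine ⟨H⁺, H⁻, nonneg_iff_posSemidef.mp (CFC.posPart_nonneg H),
    nonneg_iff_posSemidef.mp (CFC.negPart_nonneg H), CFC.posPart_sub_negPart H hs, ?_⟩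
  rw [← Complex.add_re, ← trace_add, CFC.posPart_add_negPart H hs]
  rfl

theorem abs_re_trace_le_traceNorm (hH : H.IsHermitian) : |H.trace.re| ≤ traceNorm H := by
  obtain ⟨P, Q, hP, hQ, rfl, h⟩ := exists_posSemidef_sub_eq hH
  have := hP.re_trace_nonneg
  have := hQ.re_trace_nonneg
  rw [h, trace_sub, Complex.sub_re, abs_le]
  constructor <;> linarith

theorem posSemidef_of_traceNorm_le (hH : H.IsHermitian) (h : traceNorm H ≤ H.trace.re) :
    H.PosSemidef := by
  obtain ⟨P, Q, hP, hQ, rfl, h'⟩ := exists_posSemidef_sub_eq hH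
  rw [h', trace_sub, Complex.sub_re] at h
  rw [hQ.eq_zero_of_re_trace_nonpos (by linarith), sub_zero]
  exact hP

end TraceNorm

/-! ### Explicit formulas for `2 × 2` matrices -/

section TwoByTwo

variable {P Q H : Matrix (Fin 2) (Fin 2) ℂ}

theorem trace_mul_self_fin_two (S : Matrix (Fin 2) (Fin 2) ℂ) :
    (S * S).trace = S.trace ^ 2 - 2 * S.det := by
  simp only [trace_fin_two, det_fin_two, mul_apply, Fin.sum_univ_two]
  ring

theorem trace_mul_fin_two (P Q : Matrix (Fin 2) (Fin 2) ℂ) :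
    (P * Q).trace = P.det + Q.det + P.trace * Q.trace - (P + Q).det := by
  simp only [trace_fin_two, det_fin_two, mul_apply, Matrix.add_apply, Fin.sum_univ_two]
  ring

theorem Matrix.IsHermitian.trace_eq_re (hH : H.IsHermitian) : H.trace = (H.trace.re : ℂ) := by
  rw [eq_comm, ← Complex.conj_eq_iff_re]
  conv_rhs => rw [← hH.eq, trace_conjTranspose]
  rfl

theorem Matrix.IsHermitian.det_eq_re (hH : H.IsHermitian) : H.det = (H.det.re : ℂ) := by
  rw [eq_comm, ← Complex.conj_eq_iff_re]
  conv_rhs => rw [← hH.eq, det_conjTranspose]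
  rfl

/-- If `s₁, s₂` are the singular values of `X`, this is `(s₁ + s₂)² = s₁² + s₂² + 2 s₁ s₂`. -/
theorem traceNorm_sq (X : Matrix (Fin 2) (Fin 2) ℂ) :
    traceNorm X ^ 2 = (Xᴴ * X).trace.re + 2 * ‖X.det‖ := by
  have hS := posSemidef_sqrt (Xᴴ * X)
  have hSS : CFC.sqrt (Xᴴ * X) * CFC.sqrt (Xᴴ * X) = Xᴴ * X :=
    CFC.sqrt_mul_sqrt_self _ (posSemidef_conjTranspose_mul_self X).nonneg
  rw [traceNorm]
  set S := CFC.sqrt (Xᴴ * X)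
  have hdet : S.det.re = ‖X.det‖ := by
    have h := congrArg det hSS
    rw [det_mul, det_mul, det_conjTranspose, hS.isHermitian.det_eq_re] at h
    have h2 : ((S.det.re * S.det.re : ℝ) : ℂ) = ((‖X.det‖ * ‖X.det‖ : ℝ) : ℂ) := by
      rw [Complex.ofReal_mul, h, ← pow_two ‖X.det‖, ← Complex.normSq_eq_norm_sq,
        Complex.normSq_eq_conj_mul_self]
      rfl
    exact (mul_self_inj hS.re_det_nonneg (norm_nonneg _)).mp (Complex.ofReal_injective h2)
  have h := trace_mul_self_fin_two S
  rw [hSS, hS.isHermitian.trace_eq_re, hS.isHermitian.det_eq_re] at h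
  have h' := congrArg Complex.re h
  norm_cast at h'
  rw [h', hdet]
  ring

theorem traceNorm_sq_of_isHermitian (hH : H.IsHermitian) :
    traceNorm H ^ 2 = H.trace.re ^ 2 - 2 * H.det.re + 2 * |H.det.re| := by
  rw [traceNorm_sq, hH.eq, trace_mul_self_fin_two]
  conv_lhs => rw [hH.trace_eq_re, hH.det_eq_re, Complex.norm_real]
  norm_cast

theorem Matrix.PosSemidef.re_trace_mul_nonneg (hP : P.PosSemidef) (hQ : Q.PosSemidef) :
    0 ≤ (P * Q).trace.re := by
  have h := CFC.sqrt_mul_sqrt_self P hP.nonneg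
  have hs := posSemidef_sqrt P
  have := (hQ.conjTranspose_mul_mul_same (CFC.sqrt P)).re_trace_nonneg
  rwa [hs.isHermitian.eq, trace_mul_comm, ← mul_assoc, h] at this

theorem traceNorm_sub_le (hP : P.PosSemidef) (hQ : Q.PosSemidef) :
    traceNorm (P - Q) ≤ P.trace.re + Q.trace.re := by
  have hp := hP.re_trace_nonneg
  have hq := hQ.re_trace_nonneg
  refine abs_le_of_sq_le_sq' ?_ (by positivity) |>.2
  rw [traceNorm_sq_of_isHermitian (hP.isHermitian.sub hQ.isHermitian), trace_sub, Complex.sub_re]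
  have hdet : (P - Q).det.re =
      P.det.re + Q.det.re - P.trace.re * Q.trace.re + (P * Q).trace.re := by
    have h : (P - Q).det = P.det + Q.det - P.trace * Q.trace + (P * Q).trace := by
      simp only [trace_fin_two, det_fin_two, mul_apply, Matrix.sub_apply, Fin.sum_univ_two]
      ring
    rw [hP.isHermitian.trace_eq_re, hQ.isHermitian.trace_eq_re] at h
    rw [h]
    simp
  have := hP.re_trace_mul_nonneg hQ
  have := hP.re_det_nonneg
  have := hQ.re_det_nonneg
  rcases abs_cases (P - Q).det.re with ⟨h, -⟩ | ⟨h, -⟩ <;> rw [h] <;> nlinarith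

/-- Positive trace-preserving maps contract the trace norm on Hermitian matrices. -/
theorem IsPositiveMap.traceNorm_map_le
    {T : Matrix (Fin 2) (Fin 2) ℂ →ₗ[ℂ] Matrix (Fin 2) (Fin 2) ℂ} (hT : IsPositiveMap T)
    (hT' : IsTracePreserving T) (hH : H.IsHermitian) : traceNorm (T H) ≤ traceNorm H := by
  obtain ⟨P, Q, hP, hQ, rfl, h⟩ := exists_posSemidef_sub_eq hH
  rw [h, map_sub, ← hT' P, ← hT' Q]
  exact traceNorm_sub_le (hT P hP) (hT Q hQ)

/-- The square of the fidelity `‖√P √Q‖₁` of two positive semidefinite `2 × 2` matrices. -/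
theorem traceNorm_sqrt_mul_sqrt_sq (hP : P.PosSemidef) (hQ : Q.PosSemidef) :
    traceNorm (CFC.sqrt P * CFC.sqrt Q) ^ 2 =
      (P * Q).trace.re + 2 * √(P.det.re * Q.det.re) := by
  have hp := CFC.sqrt_mul_sqrt_self P hP.nonneg
  have hq := CFC.sqrt_mul_sqrt_self Q hQ.nonneg
  have hsp := posSemidef_sqrt P
  have hsq := posSemidef_sqrt Q
  rw [traceNorm_sq, conjTranspose_mul, hsp.isHermitian.eq, hsq.isHermitian.eq]
  congr 2
  · rw [mul_assoc, trace_mul_comm, ← mul_assoc, hp, mul_assoc, hq]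
  · have hdet {R : Matrix (Fin 2) (Fin 2) ℂ} (hR : R.PosSemidef) :
        (CFC.sqrt R).det.re ^ 2 = R.det.re := by
      have h := congrArg det (CFC.sqrt_mul_sqrt_self R hR.nonneg)
      rw [det_mul, (posSemidef_sqrt R).isHermitian.det_eq_re] at h
      rw [← h, ← Complex.ofReal_mul, Complex.ofReal_re, pow_two]
    rw [det_mul, hsp.isHermitian.det_eq_re, hsq.isHermitian.det_eq_re, ← Complex.ofReal_mul,
      Complex.norm_real, Real.norm_eq_abs, ← hdet hP, ← hdet hQ, ← mul_pow, Real.sqrt_sq_eq_abs]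

/-- A singular Hermitian `2 × 2` matrix with nonnegative diagonal has the form `u uᴴ`. -/
theorem exists_eq_vecMulVec (hH : H.IsHermitian) (h0 : 0 ≤ (H 0 0).re) (h1 : 0 ≤ (H 1 1).re)
    (hdet : H.det = 0) : ∃ u : Fin 2 → ℂ, H = vecMulVec u (star u) := by
  have e00 : H 0 0 = ((H 0 0).re : ℂ) := (Complex.conj_eq_iff_re.mp (hH.apply 0 0)).symm
  have e11 : H 1 1 = ((H 1 1).re : ℂ) := (Complex.conj_eq_iff_re.mp (hH.apply 1 1)).symm
  have e01 : H 0 1 = star (H 1 0) := (hH.apply 0 1).symm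
  rw [det_fin_two, sub_eq_zero] at hdet
  rcases h0.eq_or_lt with h | h
  · rw [← h, Complex.ofReal_zero] at e00
    have h10 : H 1 0 = 0 := by
      rw [e00, zero_mul, e01, eq_comm] at hdet
      simpa using hdet
    rw [h10, star_zero] at e01
    refine ⟨![0, (√(H 1 1).re : ℝ)], ?_⟩
    ext i j
    fin_cases i <;> fin_cases j <;> simp [vecMulVec_apply, e00, e01, h10]
    rw [← Complex.ofReal_mul, Real.mul_self_sqrt h1, ← e11]
  · have hs : ((√(H 0 0).re : ℝ) : ℂ) ≠ 0 := by
      exact_mod_cast (Real.sqrt_pos.mpr h).ne'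
    have hss : ((√(H 0 0).re : ℝ) : ℂ) * ((√(H 0 0).re : ℝ) : ℂ) = H 0 0 := by
      rw [← Complex.ofReal_mul, Real.mul_self_sqrt h0, ← e00]
    refine ⟨![(√(H 0 0).re : ℝ), H 1 0 / (√(H 0 0).re : ℝ)], ?_⟩
    ext i j
    fin_cases i <;> fin_cases j <;> simp [vecMulVec_apply]
    · rw [hss]
    · rw [mul_div_cancel₀ _ hs, e01]
      rfl
    · rw [div_mul_cancel₀ _ hs]
    · rw [div_mul_div_comm, hss, eq_div_iff (by rw [← hss]; exact mul_ne_zero hs hs), mul_comm,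
        hdet, e01, mul_comm]
      rfl

/-- The trace and the determinant of a `2 × 2` matrix from its set of eigenvalues. -/
theorem trace_det_of_spectrum {C : Matrix (Fin 2) (Fin 2) ℂ} {x y : ℂ}
    (h : spectrum ℂ C = {x, y}) : C.trace = x + y ∧ C.det = x * y := by
  have key (z : ℂ) : z ∈ ({x, y} : Set ℂ) ↔ z ^ 2 - C.trace * z + C.det = 0 := by
    rw [← h, spectrum.mem_iff, isUnit_iff_isUnit_det, isUnit_iff_ne_zero, not_not,
      algebraMap_eq_diagonal]
    simp only [det_fin_two, trace_fin_two, Matrix.sub_apply]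
    simp
    ring_nf
  have hx := (key x).mp (by simp)
  have hy := (key y).mp (by simp)
  have ht : C.trace = x + y := by
    by_cases hxy : x = y
    · -- the second root `tr C - x` also belongs to the one-point spectrum
      have : C.trace - x ∈ ({x, y} : Set ℂ) := (key _).mpr (by linear_combination hx)
      rw [← hxy] at this ⊢
      have : C.trace - x = x := by simpa using this
      linear_combination this
    · have : (x - y) * (x + y - C.trace) = 0 := by linear_combination hx - hy
      rcases mul_eq_zero.mp this with h | h
      · exact absurd (sub_eq_zero.mp h) hxy
      · linear_combination -h
  refine ⟨ht, ?_⟩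
  rw [ht] at hx
  linear_combination hx

/-- Every value `g` with `|g| ≤ ‖X‖₁` is attained as `tr (X W)` at a multiple `W` of a unitary
matrix. For `X` with singular values `s₁, s₂`, the unitary factor of the polar decomposition is,
up to taking adjoints, `(Xᴴ + ω adj X) / (s₁ + s₂)` with `ω` the phase for which
`ω det X = |det X|`. -/
theorem exists_trace_mul_eq (X : Matrix (Fin 2) (Fin 2) ℂ) (g : ℂ) (hg : ‖g‖ ≤ traceNorm X) :
    ∃ (W : Matrix (Fin 2) (Fin 2) ℂ) (r : ℝ), r ≤ 1 ∧ W * Wᴴ = (r : ℂ) • 1 ∧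
      (X * W).trace = g := by
  rcases (traceNorm_nonneg X).eq_or_lt with h | hF
  · rw [← h, norm_le_zero_iff] at hg
    exact ⟨0, 0, zero_le_one, by simp, by simp [hg]⟩
  obtain ⟨ω, hω, hω'⟩ : ∃ ω : ℂ, ω * star ω = 1 ∧ ω * X.det = ‖X.det‖ := by
    by_cases hx : X.det = 0
    · exact ⟨1, by simp, by simp [hx]⟩
    have hn : (‖X.det‖ : ℂ) ≠ 0 := by simpa using hx
    have hc : star X.det * X.det = (‖X.det‖ : ℂ) ^ 2 := by
      exact Complex.conj_mul' _
    refine ⟨star X.det / ‖X.det‖, ?_, ?_⟩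
    · have : star (star X.det / (‖X.det‖ : ℂ)) = X.det / ‖X.det‖ := by simp
      rw [this]
      field_simp
      linear_combination hc
    · field_simp
      linear_combination hc
  have hsq : (traceNorm X : ℂ) ^ 2 = (Xᴴ * X).trace + 2 * ‖X.det‖ := by
    rw [(posSemidef_conjTranspose_mul_self X).isHermitian.trace_eq_re]
    exact_mod_cast traceNorm_sq X
  have hF' : (traceNorm X : ℂ) ≠ 0 := by exact_mod_cast hF.ne'
  have hV : (Xᴴ + ω • X.adjugate) * (Xᴴ + ω • X.adjugate)ᴴ = ((traceNorm X : ℂ) ^ 2) • 1 := by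
    have hω2 : star ω * star X.det = ‖X.det‖ := by
      rw [← star_mul', hω']
      simp
    have hcross : Xᴴ * X.adjugateᴴ = star X.det • 1 := by
      rw [← conjTranspose_mul, adjugate_mul, conjTranspose_smul, conjTranspose_one]
    have hdiag : Xᴴ * X + X.adjugate * X.adjugateᴴ = (Xᴴ * X).trace • 1 := by
      ext i j
      simp only [Matrix.add_apply, mul_apply, Matrix.smul_apply, conjTranspose_apply,
        adjugate_fin_two, trace_fin_two, Fin.sum_univ_two]
      fin_cases i <;> fin_cases j <;> simp <;> ring
    rw [conjTranspose_add, conjTranspose_conjTranspose, conjTranspose_smul, add_mul, mul_add,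
      mul_add, mul_smul_comm, smul_mul_assoc, smul_mul_assoc, mul_smul_comm, hcross,
      adjugate_mul, smul_smul, smul_smul, smul_smul, hω, hω', hω2, hsq, add_smul, ← hdiag]
    module
  refine ⟨(g / (traceNorm X : ℂ) ^ 2) • (Xᴴ + ω • X.adjugate), ‖g‖ ^ 2 / traceNorm X ^ 2,
    ?_, ?_, ?_⟩
  · rw [div_le_one (by positivity)]
    gcongr
  · rw [conjTranspose_smul, smul_mul_smul_comm, hV, smul_smul]
    congr 1
    have hc : g * star g = (‖g‖ : ℂ) ^ 2 := Complex.mul_conj' _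
    have : star (g / (traceNorm X : ℂ) ^ 2) = star g / (traceNorm X : ℂ) ^ 2 := by simp
    rw [this]
    push_cast
    field_simp
    linear_combination hc
  · rw [mul_smul_comm, trace_smul, mul_add, mul_smul_comm, mul_adjugate, smul_smul, hω', trace_add,
      trace_mul_comm, trace_smul, trace_one]
    simp only [smul_eq_mul, Fintype.card_fin]
    field_simp
    linear_combination -g * hsq

end TwoByTwo

/-! ### Channels from Kraus operators -/

section Kraus

variable {n : ℕ} {ι : Type*} [Fintype ι]

/-- The linear map `X ↦ ∑ j, K j * X * (K j)ᴴ` with Kraus operators `K j`. -/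
noncomputable def krausMap (K : ι → Matrix (Fin n) (Fin n) ℂ) :
    Matrix (Fin n) (Fin n) ℂ →ₗ[ℂ] Matrix (Fin n) (Fin n) ℂ where
  toFun X := ∑ j, K j * X * (K j)ᴴ
  map_add' X Y := by simp [mul_add, add_mul, Finset.sum_add_distrib]
  map_smul' c X := by simp [Finset.smul_sum]

theorem krausMap_apply (K : ι → Matrix (Fin n) (Fin n) ℂ) (X : Matrix (Fin n) (Fin n) ℂ) :
    krausMap K X = ∑ j, K j * X * (K j)ᴴ :=
  rfl

theorem ampliation_krausMap (K : ι → Matrix (Fin n) (Fin n) ℂ) (m : ℕ)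
    (X : Matrix (Fin n × Fin m) (Fin n × Fin m) ℂ) :
    ampliation (krausMap K) m X =
      ∑ j, (K j ⊗ₖ (1 : Matrix (Fin m) (Fin m) ℂ)) * X * (K j ⊗ₖ 1)ᴴ := by
  ext ⟨i, k⟩ ⟨i', k'⟩
  change (∑ j, K j * (Matrix.of fun a b => X (a, k) (b, k')) * (K j)ᴴ) i i' = _
  simp only [Matrix.sum_apply, mul_apply, Fintype.sum_prod_type, conjTranspose_apply,
    kroneckerMap_apply, one_apply, of_apply]
  refine Finset.sum_congr rfl fun j _ => Finset.sum_congr rfl fun a _ => ?_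
  simp [apply_ite (starRingEnd ℂ)]

theorem isCompletelyPositiveMap_krausMap (K : ι → Matrix (Fin n) (Fin n) ℂ) :
    IsCompletelyPositiveMap (krausMap K) := fun m X hX => by
  rw [ampliation_krausMap]
  exact posSemidef_sum _ fun j _ => hX.mul_mul_conjTranspose_same _

theorem isTracePreserving_krausMap {K : ι → Matrix (Fin n) (Fin n) ℂ}
    (hK : ∑ j, (K j)ᴴ * K j = 1) : IsTracePreserving (krausMap K) := fun X => by
  rw [krausMap_apply, trace_sum]
  simp_rw [trace_mul_comm _ (_)ᴴ, ← mul_assoc]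
  rw [← trace_sum, ← Finset.sum_mul, hK, one_mul]

theorem isQuantumChannel_id : IsQuantumChannel
    (LinearMap.id : Matrix (Fin n) (Fin n) ℂ →ₗ[ℂ] Matrix (Fin n) (Fin n) ℂ) :=
  ⟨fun _ _ hX => hX, fun _ => rfl⟩

theorem IsCompletelyPositiveMap.isPositiveMap
    {T : Matrix (Fin n) (Fin n) ℂ →ₗ[ℂ] Matrix (Fin n) (Fin n) ℂ}
    (hT : IsCompletelyPositiveMap T) : IsPositiveMap T := fun X hX =>
  (hT 1 (X.submatrix Prod.fst Prod.fst) (hX.submatrix _)).submatrix fun i => (i, 0)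

/-- The columns of an invertible `G` are mapped to mixtures `M k * (M k)ᴴ` by a channel as soon
as the purifications `M k`, regarded as vectors in `ℂⁿ ⊗ ℂ^ι`, have the Gram matrix `Gᴴ * G` of
these columns: the isometry `G eₖ ↦ M k` followed by the partial trace is such a channel. -/
theorem exists_isQuantumChannel_of_gram (G : Matrix (Fin n) (Fin n) ℂ) (hG : IsUnit G.det)
    (M : Fin n → Matrix (Fin n) ι ℂ) (hM : ∀ k l, ((M k)ᴴ * M l).trace = (Gᴴ * G) k l) :
    ∃ T : Matrix (Fin n) (Fin n) ℂ →ₗ[ℂ] Matrix (Fin n) (Fin n) ℂ, IsQuantumChannel T ∧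
      ∀ k, T (vecMulVec (G.col k) (star (G.col k))) = M k * (M k)ᴴ := by
  set L : ι → Matrix (Fin n) (Fin n) ℂ := fun j => Matrix.of fun i k => M k i j
  have hL : ∑ j, (L j)ᴴ * L j = Gᴴ * G := by
    ext k l
    rw [← hM, Matrix.sum_apply]
    rfl
  refine ⟨krausMap fun j => L j * G⁻¹, ⟨isCompletelyPositiveMap_krausMap _,
    isTracePreserving_krausMap ?_⟩, fun k => ?_⟩
  · have h (j : ι) : (L j * G⁻¹)ᴴ * (L j * G⁻¹) = (G⁻¹)ᴴ * ((L j)ᴴ * L j) * G⁻¹ := by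
      simp only [conjTranspose_mul, mul_assoc]
    simp_rw [h]
    rw [← Finset.sum_mul, ← Finset.mul_sum, hL, mul_assoc, mul_assoc, mul_nonsing_inv G hG,
      mul_one, ← conjTranspose_mul, mul_nonsing_inv G hG, conjTranspose_one]
  · have h (j : ι) : (L j * G⁻¹) *ᵥ G.col k = fun i => M k i j := by
      have hk : G.col k = G *ᵥ Pi.single k 1 := (mulVec_single_one G k).symm
      rw [hk, mulVec_mulVec, mul_assoc, nonsing_inv_mul G hG, mul_one, mulVec_single_one]
      rfl
    rw [krausMap_apply]
    ext i i'
    simp_rw [mul_vecMulVec, vecMulVec_mul, ← star_mulVec, h]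
    rw [Matrix.sum_apply]
    rfl

/-- A pair of pure states can be mapped to a pair of mixed states of the same traces by a channel
if this does not decrease the fidelity. -/
theorem exists_isQuantumChannel_of_fidelity_le (u v : Fin 2 → ℂ)
    (hG : IsUnit (Matrix.of ![u, v]).det) {P Q : Matrix (Fin 2) (Fin 2) ℂ}
    (hP : P.PosSemidef) (hQ : Q.PosSemidef) (hPu : P.trace = star u ⬝ᵥ u)
    (hQv : Q.trace = star v ⬝ᵥ v)
    (hF : ‖star u ⬝ᵥ v‖ ≤ traceNorm (CFC.sqrt P * CFC.sqrt Q)) :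
    ∃ T : Matrix (Fin 2) (Fin 2) ℂ →ₗ[ℂ] Matrix (Fin 2) (Fin 2) ℂ, IsQuantumChannel T ∧
      T (vecMulVec u (star u)) = P ∧ T (vecMulVec v (star v)) = Q := by
  obtain ⟨W, r, hr, hW, hWg⟩ := exists_trace_mul_eq _ _ hF
  have hp := CFC.sqrt_mul_sqrt_self P hP.nonneg
  have hq := CFC.sqrt_mul_sqrt_self Q hQ.nonneg
  have hsp := (posSemidef_sqrt P).isHermitian.eq
  have hsq := (posSemidef_sqrt Q).isHermitian.eq
  set S := CFC.sqrt P
  set R := CFC.sqrt Q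
  set M : Matrix (Fin 2) (Fin 2 ⊕ Fin 2) ℂ := fromCols S 0
  -- the second block turns the contraction `W` into a coisometry
  set N : Matrix (Fin 2) (Fin 2 ⊕ Fin 2) ℂ := fromCols (R * W) ((√(1 - r) : ℂ) • R)
  have hMM : M * Mᴴ = P := by
    simp [M, conjTranspose_fromCols_eq_fromRows_conjTranspose, fromCols_mul_fromRows, hsp, hp]
  have hNN : N * Nᴴ = Q := by
    have h1 : R * W * (R * W)ᴴ = (r : ℂ) • Q := by
      rw [conjTranspose_mul, hsq, mul_assoc, ← mul_assoc W, hW, smul_mul_assoc, one_mul,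
        mul_smul_comm, hq]
    have h2 : (√(1 - r) : ℂ) • R * ((√(1 - r) : ℂ) • R)ᴴ = ((1 - r : ℝ) : ℂ) • Q := by
      rw [conjTranspose_smul, smul_mul_smul_comm, hsq, hq]
      congr 1
      rw [Complex.star_def, Complex.conj_ofReal, ← Complex.ofReal_mul,
        Real.mul_self_sqrt (by linarith)]
    rw [conjTranspose_fromCols_eq_fromRows_conjTranspose, fromCols_mul_fromRows, h1, h2,
      ← add_smul]
    simp
  have hMN : (Mᴴ * N).trace = star u ⬝ᵥ v := by
    rw [trace_mul_comm, conjTranspose_fromCols_eq_fromRows_conjTranspose, fromCols_mul_fromRows,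
      conjTranspose_zero, mul_zero, add_zero, hsp, mul_assoc, trace_mul_comm, mul_assoc,
      trace_mul_comm, ← hWg]
  obtain ⟨T, hT, hTG⟩ := exists_isQuantumChannel_of_gram (Matrix.of ![u, v])ᵀ
    (by rwa [det_transpose]) ![M, N] (by
      have hNM : (Nᴴ * M).trace = star v ⬝ᵥ u := by
        rw [← conjTranspose_conjTranspose M, ← conjTranspose_mul, trace_conjTranspose,
          hMN]
        exact (star_dotProduct v u).symm
      intro k l
      have hcol : (((Matrix.of ![u, v])ᵀ)ᴴ * (Matrix.of ![u, v])ᵀ) k l =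
          star (![u, v] k) ⬝ᵥ ![u, v] l := rfl
      rw [hcol]
      fin_cases k <;> fin_cases l
      · change (Mᴴ * M).trace = star u ⬝ᵥ u
        rw [trace_mul_comm, hMM, hPu]
      · exact hMN
      · exact hNM
      · change (Nᴴ * N).trace = star v ⬝ᵥ v
        rw [trace_mul_comm, hNN, hQv])
  exact ⟨T, hT, (hTG 0).trans hMM, (hTG 1).trans hNN⟩

end Kraus

/-! ### Pencils `B - t D` with `D` diagonal and positive -/

section Diag

variable {d : Fin 2 → ℝ}

theorem invSqrt_realDiag {n : ℕ} {d : Fin n → ℝ} (hd : ∀ i, 0 < d i) :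
    invSqrt (realDiag d) = realDiag fun i => (√(d i))⁻¹ := by
  have hsqrt : CFC.sqrt (realDiag d) = realDiag fun i => √(d i) := by
    refine CFC.sqrt_unique ?_ (PosSemidef.diagonal ?_).nonneg
    · rw [realDiag, realDiag, diagonal_mul_diagonal]
      congr 1
      ext i
      rw [← Complex.ofReal_mul, Real.mul_self_sqrt (hd i).le]
    · intro i
      change (0 : ℂ) ≤ (√(d i) : ℂ)
      exact_mod_cast Real.sqrt_nonneg (d i)
  rw [invSqrt, hsqrt]
  refine inv_eq_right_inv ?_
  rw [realDiag, realDiag, diagonal_mul_diagonal, ← diagonal_one]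
  congr 1
  ext i
  rw [← Complex.ofReal_mul, mul_inv_cancel₀ (Real.sqrt_pos.mpr (hd i)).ne', Complex.ofReal_one]

theorem isHermitian_smul_realDiag {n : ℕ} (d : Fin n → ℝ) (t : ℝ) :
    (t • realDiag d).IsHermitian := by
  ext i j
  by_cases h : i = j
  · subst h
    simp [realDiag]
  · simp [realDiag, h, Ne.symm h]

/-- The coefficients of the polynomial `det (B - t D) = (t - b₁) (t - b₂) det D`, where `b₁, b₂` are
the eigenvalues of `D^{-1/2} B D^{-1/2}`. -/
theorem diag_det_of_spectrum (hd : ∀ i, 0 < d i) {B : Matrix (Fin 2) (Fin 2) ℂ} {b₁ b₂ : ℝ}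
    (hσ : spectrum ℂ (invSqrt (realDiag d) * B * invSqrt (realDiag d)) = {(b₁ : ℂ), (b₂ : ℂ)}) :
    B 0 0 * d 1 + B 1 1 * d 0 = (b₁ + b₂) * (d 0 * d 1) ∧ B.det = b₁ * b₂ * (d 0 * d 1) := by
  obtain ⟨ht, hdet⟩ := trace_det_of_spectrum hσ
  rw [invSqrt_realDiag hd] at ht hdet
  have hs (i : Fin 2) : (√(d i) : ℂ) * √(d i) = d i := by
    exact_mod_cast Real.mul_self_sqrt (hd i).le
  have hn (i : Fin 2) : (√(d i) : ℂ) ≠ 0 := by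
    exact_mod_cast (Real.sqrt_pos.mpr (hd i)).ne'
  have hn0 := hn 0
  have hn1 := hn 1
  rw [det_mul, det_mul] at hdet
  simp [realDiag, trace_fin_two, mul_diagonal] at ht hdet
  rw [← hs 0, ← hs 1, ← ht, ← hdet]
  constructor <;> field_simp

/-- `B - b₁ D` and `b₂ D - B` are positive semidefinite of rank at most one if `b₁ ≤ b₂`
are the eigenvalues of `D^{-1/2} B D^{-1/2}`. -/
theorem exists_vecMulVec_of_spectrum (hd : ∀ i, 0 < d i) {B : Matrix (Fin 2) (Fin 2) ℂ}
    (hB : B.IsHermitian) {b₁ b₂ : ℝ} (hb : b₁ ≤ b₂)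
    (hσ : spectrum ℂ (invSqrt (realDiag d) * B * invSqrt (realDiag d)) = {(b₁ : ℂ), (b₂ : ℂ)}) :
    ∃ u v : Fin 2 → ℂ, B - b₁ • realDiag d = vecMulVec u (star u) ∧
      b₂ • realDiag d - B = vecMulVec v (star v) := by
  obtain ⟨ht, hdet⟩ := diag_det_of_spectrum hd hσ
  have h0 := hd 0
  have h1 := hd 1
  have ht' : (B 0 0).re * d 1 + (B 1 1).re * d 0 = (b₁ + b₂) * (d 0 * d 1) := by
    have := congrArg Complex.re ht
    norm_cast at this
    simpa using this
  -- a Hermitian matrix with vanishing determinant is nonnegative once its weighted trace is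
  have key (H : Matrix (Fin 2) (Fin 2) ℂ) (hH : H.IsHermitian) (hz : H.det = 0)
      (hw : 0 ≤ (H 0 0).re * d 1 + (H 1 1).re * d 0) :
      ∃ u : Fin 2 → ℂ, H = vecMulVec u (star u) := by
    have hp : 0 ≤ (H 0 0).re * (H 1 1).re := by
      have e00 : H 0 0 = ((H 0 0).re : ℂ) := (Complex.conj_eq_iff_re.mp (hH.apply 0 0)).symm
      have e11 : H 1 1 = ((H 1 1).re : ℂ) := (Complex.conj_eq_iff_re.mp (hH.apply 1 1)).symm
      have e01 : H 0 1 * H 1 0 = (Complex.normSq (H 1 0) : ℂ) := by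
        rw [← hH.apply 0 1, Complex.normSq_eq_conj_mul_self]
        rfl
      rw [det_fin_two, e01, e00, e11, sub_eq_zero] at hz
      have : (H 0 0).re * (H 1 1).re = Complex.normSq (H 1 0) := by exact_mod_cast hz
      rw [this]
      exact Complex.normSq_nonneg _
    refine exists_eq_vecMulVec hH ?_ ?_ hz
    · by_contra! h
      nlinarith [mul_pos_of_neg_of_neg h h]
    · by_contra! h
      nlinarith [mul_pos_of_neg_of_neg h h]
  have hdd : 0 ≤ (b₂ - b₁) * (d 0 * d 1) := by
    have := sub_nonneg.mpr hb
    positivity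
  rw [det_fin_two] at hdet
  have h₁ : (B - b₁ • realDiag d).det = 0 := by
    simp only [det_fin_two, Matrix.sub_apply, Matrix.smul_apply, realDiag]
    simp
    linear_combination hdet - b₁ * ht
  have h₂ : (b₂ • realDiag d - B).det = 0 := by
    simp only [det_fin_two, Matrix.sub_apply, Matrix.smul_apply, realDiag]
    simp
    linear_combination hdet - b₂ * ht
  obtain ⟨u, hu⟩ := key _ (hB.sub (isHermitian_smul_realDiag d b₁)) h₁ (by
    simp [realDiag]
    linarith)
  obtain ⟨v, hv⟩ := key _ ((isHermitian_smul_realDiag d b₂).sub hB) h₂ (by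
    simp [realDiag]
    linarith)
  exact ⟨u, v, hu, hv⟩

end Diag

/-! ### Characterizations of `D`-majorization -/

/-- For `P + Q = P' + Q'` with `P, Q` of the same traces as `P', Q'`, the fidelity of `P, Q` is at
least that of `P', Q'` if the latter are singular: by `traceNorm_sqrt_mul_sqrt_sq` and
`trace_mul_fin_two`, the squared fidelity is `(√det P + √det Q)²` plus a quantity that depends
only on `P + Q` and the two traces. -/
theorem traceNorm_sqrt_mul_sqrt_le {P Q P' Q' : Matrix (Fin 2) (Fin 2) ℂ}
    (hP : P.PosSemidef) (hQ : Q.PosSemidef) (hP' : P'.PosSemidef) (hQ' : Q'.PosSemidef)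
    (hPd : P'.det = 0) (hQd : Q'.det = 0) (hPt : P.trace = P'.trace) (hQt : Q.trace = Q'.trace)
    (hs : P + Q = P' + Q') :
    traceNorm (CFC.sqrt P' * CFC.sqrt Q') ≤ traceNorm (CFC.sqrt P * CFC.sqrt Q) := by
  refine abs_le_of_sq_le_sq' ?_ (traceNorm_nonneg _) |>.2
  rw [traceNorm_sqrt_mul_sqrt_sq hP' hQ', traceNorm_sqrt_mul_sqrt_sq hP hQ,
    trace_mul_fin_two P' Q', trace_mul_fin_two P Q, hs, hPt, hQt, hPd, hQd]
  have := hP.re_det_nonneg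
  have := hQ.re_det_nonneg
  have := Real.sqrt_nonneg (P.det.re * Q.det.re)
  simp only [Complex.sub_re, Complex.add_re, Complex.zero_re, mul_zero, Real.sqrt_zero]
  linarith

theorem proposition4p5 (d : Fin 2 → ℝ) (hd : ∀ i, 0 < d i)
    (A B : Matrix (Fin 2) (Fin 2) ℂ) (hA : A.IsHermitian) (hB : B.IsHermitian)
    (b₁ b₂ : ℝ) (hb : b₁ ≤ b₂)
    (hσ : spectrum ℂ (invSqrt (realDiag d) * B * invSqrt (realDiag d)) = {(b₁ : ℂ), (b₂ : ℂ)}) :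
    List.TFAE
      [DMajorizedBy (realDiag d) A B,
        ∃ T : Matrix (Fin 2) (Fin 2) ℂ →ₗ[ℂ] Matrix (Fin 2) (Fin 2) ℂ,
          IsPositiveMap T ∧ IsTracePreserving T ∧ T B = A ∧ T (realDiag d) = realDiag d,
        ∀ t : ℝ, traceNorm (A - t • realDiag d) ≤ traceNorm (B - t • realDiag d),
        A.trace = B.trace ∧
          traceNorm (A - b₁ • realDiag d) ≤ traceNorm (B - b₁ • realDiag d) ∧
          traceNorm (A - b₂ • realDiag d) ≤ traceNorm (B - b₂ • realDiag d) ∧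
          traceNorm (CFC.sqrt (B - b₁ • realDiag d) * CFC.sqrt (b₂ • realDiag d - B)) ≤
            traceNorm (CFC.sqrt (A - b₁ • realDiag d) * CFC.sqrt (b₂ • realDiag d - A))] := by
  obtain ⟨u, v, hu, hv⟩ := exists_vecMulVec_of_spectrum hd hB hb hσ
  set D := realDiag d
  have hPB : (B - b₁ • D).PosSemidef := hu ▸ posSemidef_vecMulVec_self_star u
  have hQB : (b₂ • D - B).PosSemidef := hv ▸ posSemidef_vecMulVec_self_star v
  have hA₁ : (A - b₁ • D).IsHermitian := hA.sub (isHermitian_smul_realDiag d b₁)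
  have hA₂ : (b₂ • D - A).IsHermitian := (isHermitian_smul_realDiag d b₂).sub hA
  have hneg (X : Matrix (Fin 2) (Fin 2) ℂ) : traceNorm (X - b₂ • D) = traceNorm (b₂ • D - X) := by
    rw [← neg_sub, traceNorm, traceNorm, conjTranspose_neg, neg_mul_neg]
  have htr₁ (h : A.trace = B.trace) : (A - b₁ • D).trace = (B - b₁ • D).trace := by
    rw [trace_sub, trace_sub, h]
  have htr₂ (h : A.trace = B.trace) : (b₂ • D - A).trace = (b₂ • D - B).trace := by
    rw [trace_sub, trace_sub, h]
  have hPA (ht : A.trace = B.trace) (h : traceNorm (A - b₁ • D) ≤ traceNorm (B - b₁ • D)) :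
      (A - b₁ • D).PosSemidef := by
    refine posSemidef_of_traceNorm_le hA₁ ?_
    rwa [htr₁ ht, ← traceNorm_of_posSemidef hPB]
  have hQA (ht : A.trace = B.trace) (h : traceNorm (A - b₂ • D) ≤ traceNorm (B - b₂ • D)) :
      (b₂ • D - A).PosSemidef := by
    refine posSemidef_of_traceNorm_le hA₂ ?_
    rwa [htr₂ ht, ← traceNorm_of_posSemidef hQB, ← hneg, ← hneg]
  tfae_have 1 → 2 := fun ⟨T, hT, hTB, hTD⟩ => ⟨T, hT.1.isPositiveMap, hT.2, hTB, hTD⟩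
  tfae_have 2 → 3 := by
    rintro ⟨T, hT, hT', hTB, hTD⟩ t
    have h : T (B - t • D) = A - t • D := by
      rw [map_sub, hTB, LinearMap.map_smul_of_tower, hTD]
    rw [← h]
    exact hT.traceNorm_map_le hT' (hB.sub (isHermitian_smul_realDiag d t))
  tfae_have 3 → 4 := by
    intro h
    have ht : A.trace = B.trace := by
      -- `‖B - b₁ D‖₁ = tr (B - b₁ D)` and `‖B - b₂ D‖₁ = tr (b₂ D - B)`, so `t = b₁` and `t = b₂`
      -- give the two inequalities between the traces
      have l₁ := (abs_re_trace_le_traceNorm hA₁).trans (h b₁)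
      have l₂ := (abs_re_trace_le_traceNorm hA₂).trans_eq (hneg A).symm |>.trans (h b₂)
      rw [traceNorm_of_posSemidef hPB] at l₁
      rw [hneg, traceNorm_of_posSemidef hQB] at l₂
      have l₁' := (le_abs_self _).trans l₁
      have l₂' := (le_abs_self _).trans l₂
      simp only [trace_sub, Complex.sub_re] at l₁' l₂'
      rw [hA.trace_eq_re, hB.trace_eq_re]
      congr 1
      linarith
    refine ⟨ht, h b₁, h b₂, ?_⟩
    refine traceNorm_sqrt_mul_sqrt_le (hPA ht (h b₁)) (hQA ht (h b₂)) hPB hQB ?_ ?_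
      (htr₁ ht) (htr₂ ht) (by abel)
    · rw [hu, det_vecMulVec]
    · rw [hv, det_vecMulVec]
  tfae_have 4 → 1 := by
    rintro ⟨ht, h₁, h₂, hF⟩
    have hP := hPA ht h₁
    have hQ := hQA ht h₂
    rcases hb.eq_or_lt with rfl | hlt
    · -- `A - b₁ D` and `B - b₁ D` vanish, as they and their negatives are positive semidefinite
      have hz {X : Matrix (Fin 2) (Fin 2) ℂ} (hX : (X - b₁ • D).PosSemidef)
          (hX' : (b₁ • D - X).PosSemidef) : X = b₁ • D :=
        le_antisymm (Matrix.le_iff.mpr hX') (Matrix.le_iff.mpr hX)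
      exact ⟨LinearMap.id, isQuantumChannel_id, by rw [hz hP hQ]; exact hz hPB hQB, rfl⟩
    have hδ : b₂ - b₁ ≠ 0 := (sub_pos.mpr hlt).ne'
    have hsum : vecMulVec u (star u) + vecMulVec v (star v) = (b₂ - b₁) • D := by
      rw [← hu, ← hv]
      module
    have hG : IsUnit (Matrix.of ![u, v]).det := by
      have hGG : (Matrix.of ![u, v])ᵀ * ((Matrix.of ![u, v])ᵀ)ᴴ = (b₂ - b₁) • D := by
        rw [← hsum]
        ext i j
        simp [mul_apply, vecMulVec_apply, Fin.sum_univ_two]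
      rw [isUnit_iff_ne_zero]
      intro h0
      have := congrArg det hGG
      rw [det_mul, det_transpose, h0, zero_mul, ← Complex.coe_smul, det_smul] at this
      have h0 := (hd 0).ne'
      have h1 := (hd 1).ne'
      have h := this.symm
      rw [Complex.ofReal_sub] at h
      simp [D, realDiag, h0, h1, sub_eq_zero] at h
      exact hlt.ne' h
    have hfid : ‖star u ⬝ᵥ v‖ ≤ traceNorm (CFC.sqrt (A - b₁ • D) * CFC.sqrt (b₂ • D - A)) := by
      refine le_trans (le_of_eq ?_) hF
      refine (sq_eq_sq₀ (norm_nonneg _) (traceNorm_nonneg _)).mp ?_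
      rw [traceNorm_sqrt_mul_sqrt_sq hPB hQB, hu, hv, det_vecMulVec, vecMulVec_mul_vecMulVec,
        trace_vecMulVec, dotProduct_smul, dotProduct_star, dotProduct_comm v, smul_eq_mul]
      have hc : (star u ⬝ᵥ v) * star (star u ⬝ᵥ v) = (‖star u ⬝ᵥ v‖ : ℂ) ^ 2 :=
        Complex.mul_conj' _
      rw [hc]
      norm_cast
      simp
    obtain ⟨T, hT, hTu, hTv⟩ := exists_isQuantumChannel_of_fidelity_le u v hG hP hQ
      (by rw [htr₁ ht, hu, trace_vecMulVec, dotProduct_comm])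
      (by rw [htr₂ ht, hv, trace_vecMulVec, dotProduct_comm]) hfid
    have hTD : T D = D := by
      have h : T ((b₂ - b₁) • D) = (b₂ - b₁) • D := by
        rw [← hsum, map_add, hTu, hTv, hsum]
        module
      rw [LinearMap.map_smul_of_tower] at h
      exact smul_right_injective _ hδ h
    refine ⟨T, hT, ?_, hTD⟩
    rw [← hu, map_sub, LinearMap.map_smul_of_tower, hTD] at hTu
    exact sub_left_injective hTu
  tfae_finish
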